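/- For an integer $k\ge 1$, a $k$-CNF formula is a conjunction of finitely many clauses, each of which is a disjunction of exactly $k$ distinct literals (a literal is a Boolean variable or its negation). Two distinct clauses intersect if some variable occurs (negated or not) in both of them. Let $l(k)$ be the largest integer such that every $k$-CNF formula in which each clause intersects at most $l(k)$ other clauses is satisfiable. Then $l(k)$ exists for every $k\ge 1$, and $$\left\lfloor\frac{2^k}{e}\right\rfloor-1\le l(k)=\left(\frac1e+O\left(k^{-1/2}\right)\right)2^k ,$$ that is, the inequality holds for every $k\ge1$, and there is an absolute constant $K$ such that $\left|l(k)/2^k-1/e\right|\le K\,k^{-1/2}$ for every $k\ge 1$. -/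

import Mathlib

namespace KSat

/-- A literal over the variable set `V`: a variable together with a sign, `(x, true)` being the
literal `x` and `(x, false)` its negation. -/
abbrev Literal (V : Type*) := V × Bool

/-- A clause: the disjunction of finitely many distinct literals. -/
abbrev Clause (V : Type*) := Finset (Literal V)

/-- A CNF formula: the conjunction of finitely many clauses. -/
abbrev CNF (V : Type*) := Finset (Clause V)

variable {V : Type*} [DecidableEq V]

/-- The set of variables occurring (negated or not) in a clause. -/
def Clause.vars (C : Clause V) : Finset V := C.image Prod.fst

/-- A `k`-CNF: every clause has exactly `k` distinct literals. -/
def IsKCNF (k : ℕ) (F : CNF V) : Prop := ∀ C ∈ F, C.card = k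

/-- An assignment satisfies a formula if it makes some literal of every clause true. -/
def Satisfies (a : V → Bool) (F : CNF V) : Prop := ∀ C ∈ F, ∃ p ∈ C, a p.1 = p.2

/-- A formula is satisfiable if some assignment satisfies it. -/
def Satisfiable (F : CNF V) : Prop := ∃ a : V → Bool, Satisfies a F

/-- The clauses of `F` other than `C` that intersect `C`, that is, share a variable with it. -/
def neighbors (F : CNF V) (C : Clause V) : Finset (Clause V) :=
  F.filter fun D => D ≠ C ∧ (Clause.vars C ∩ Clause.vars D).Nonempty

/-- `d` is admissible for `k` if every `k`-CNF all of whose clauses intersect at most `d` other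
clauses is satisfiable. The variables are taken from the infinite set `ℕ`. -/
def Admissible (k d : ℕ) : Prop :=
  ∀ F : CNF ℕ, IsKCNF k F → (∀ C ∈ F, (neighbors F C).card ≤ d) → Satisfiable F

/-- The largest number admissible for `k`. -/
noncomputable def l (k : ℕ) : ℕ := sSup {d : ℕ | Admissible k d}

end KSat

/-!
Lower bound: under a uniformly random assignment a clause of size `k` is violated with probability
at most `2 ^ (-k)`, also when conditioned on the satisfaction of clauses that share no variable with
it. The conditional form of the Lovász local lemma, with weight `1 / (d + 1)` for every clause, and
`(1 + 1 / d) ^ d ≤ e` give satisfiability as soon as `e (d + 1) ≤ 2 ^ k`.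

Upper bound: take a binary tree with all leaves at depth at least `k` and use its inner nodes as
variables. An assignment selects a child of every node, hence a path from the root to a leaf. Let
the clause of a leaf say that some of its last `k` edges is not selected; then no assignment
satisfies all clauses. If from every node at most `d` leaves are reachable by fewer than `k` steps,
each clause meets at most `k d` others, because every such clause belongs to a leaf below one of
the `k` siblings of the nodes on the path.

Trees with `d ≈ 2 ^ k / (e k)` are built in generations of about `√k` levels. After each generation
a fraction of the nodes is finished, that is, continued with subtrees that have prescribed numbers
of leaves at each depth; Kraft's inequality decides when these exist. The fraction `x / √k` must
balance the growth `e ^ x` that the allotments of the unfinished nodes have gained meanwhile; since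
`e ^ (x - 1) ≥ x`, the total allotment `1 / e` suffices, and so `x` can be raised slowly from `0`
to a constant large enough for all remaining nodes to be finished at once.
-/

namespace KSat

open Finset MeasureTheory ProbabilityTheory

section Transfer

variable {V W : Type*}

/-- The renaming of the variables of clauses along an embedding. -/
def Clause.map (e : V ↪ W) : Clause V ↪ Clause W :=
  (mapEmbedding (e.prodMap (.refl Bool))).toEmbedding

theorem Clause.card_map (e : V ↪ W) (C : Clause V) : (Clause.map e C).card = C.card :=
  Finset.card_map _

variable [DecidableEq V] [DecidableEq W]

theorem Clause.vars_map (e : V ↪ W) (C : Clause V) : (Clause.map e C).vars = C.vars.map e := by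
  ext v
  simp [Clause.map, Clause.vars, or_and_right, exists_or]

theorem neighbors_map (e : V ↪ W) (F : CNF V) (C : Clause V) :
    neighbors (F.map (Clause.map e)) (Clause.map e C) = (neighbors F C).map (Clause.map e) := by
  simp only [neighbors, filter_map, Function.comp_def, Clause.vars_map, ← map_inter,
    map_nonempty, (Clause.map e).injective.ne_iff]

theorem Admissible.satisfiable [Countable V] {k d : ℕ} (h : Admissible k d) {F : CNF V}
    (hF : IsKCNF k F) (hd : ∀ C ∈ F, (neighbors F C).card ≤ d) : Satisfiable F := by
  obtain ⟨e, he⟩ := exists_injective_nat V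
  obtain ⟨a, ha⟩ := h (F.map (Clause.map ⟨e, he⟩))
    (by simpa [IsKCNF, Clause.card_map] using hF) (by simpa [neighbors_map] using hd)
  refine ⟨a ∘ e, fun C hC => ?_⟩
  obtain ⟨x, hx, hax⟩ := ha _ (mem_map_of_mem _ hC)
  obtain ⟨p, hp, rfl⟩ := Finset.mem_map.1 hx
  exact ⟨p, hp, hax⟩

end Transfer

/-! ### The local lemma and the lower bound -/

section LocalLemma

variable {Ω ι : Type*}

/-- The event that none of the events `A i` with `i ∈ S` occurs. -/
def avoid (A : ι → Set Ω) (S : Finset ι) : Set Ω := ⋂ i ∈ S, (A i)ᶜ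

theorem avoid_anti (A : ι → Set Ω) {S T : Finset ι} (h : S ⊆ T) : avoid A T ⊆ avoid A S :=
  Set.biInter_subset_biInter_left h

variable [MeasurableSpace Ω] {μ : Measure Ω} [IsFiniteMeasure μ] {A : ι → Set Ω} {x : ι → ℝ}

theorem measureReal_avoid_insert [DecidableEq ι] {i : ι} (hA : MeasurableSet (A i))
    (S : Finset ι) :
    μ.real (avoid A (insert i S)) = μ.real (avoid A S) - μ.real (A i ∩ avoid A S) := by
  have h_sdiff : avoid A (insert i S) = avoid A S \ A i := by
    simp [avoid, Set.sdiff_eq, Set.inter_comm]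
  rw [h_sdiff, Set.inter_comm, ← measureReal_inter_add_sdiff hA (s := avoid A S),
    add_sub_cancel_left]

theorem prod_one_sub_mul_measureReal_avoid_le [DecidableEq ι] {T : Finset ι} (S : Finset ι)
    (hA : ∀ i ∈ T, MeasurableSet (A i)) (hx : ∀ i ∈ T, x i ≤ 1)
    (h : ∀ i ∈ T, ∀ U ⊆ T, i ∉ U →
      μ.real (A i ∩ avoid A (U ∪ S)) ≤ x i * μ.real (avoid A (U ∪ S))) :
    (∏ i ∈ T, (1 - x i)) * μ.real (avoid A S) ≤ μ.real (avoid A (T ∪ S)) := by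
  induction T using Finset.induction with
  | empty => simp
  | insert i T hi ih =>
    rw [forall_mem_insert] at hA hx
    have ih := ih hA.2 hx.2 fun j hj U hU =>
      h j (mem_insert_of_mem hj) U (hU.trans (subset_insert i T))
    have := h i (mem_insert_self i T) T (subset_insert i T) hi
    rw [prod_insert hi, insert_union, measureReal_avoid_insert hA.1]
    nlinarith [mul_le_mul_of_nonneg_left ih (sub_nonneg.2 hx.1)]

variable {F : Finset ι} {Γ : ι → Finset ι} (hA : ∀ i ∈ F, MeasurableSet (A i))
  (hx : ∀ i, x i ∈ Set.Icc 0 1)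
  (h : ∀ i ∈ F, ∀ S ⊆ F, i ∉ S → Disjoint (Γ i) S →
    μ.real (A i ∩ avoid A S) ≤ x i * (∏ j ∈ Γ i, (1 - x j)) * μ.real (avoid A S))

include hA hx h

theorem measureReal_inter_avoid_le {i : ι} (hi : i ∈ F) {S : Finset ι} (hS : S ⊆ F)
    (hiS : i ∉ S) : μ.real (A i ∩ avoid A S) ≤ x i * μ.real (avoid A S) := by
  classical
  induction S using Finset.strongInduction generalizing i with
  | H S ih =>
    have h_near : (∏ j ∈ Γ i ∩ S, (1 - x j)) * μ.real (avoid A (S \ Γ i)) ≤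
        μ.real (avoid A S) := by
      have h_union : Γ i ∩ S ∪ S \ Γ i = S := by grind
      refine (prod_one_sub_mul_measureReal_avoid_le _ (fun j hj => hA j (hS (mem_inter.1 hj).2))
        (fun j _ => (hx j).2) fun j hj U hU hjU => ?_).trans_eq (by rw [h_union])
      exact ih _ (by grind) (by grind) (by grind) (by grind)
    have h_prod : ∏ j ∈ Γ i, (1 - x j) ≤ ∏ j ∈ Γ i ∩ S, (1 - x j) :=
      prod_le_prod_of_subset_of_le_one inter_subset_left (fun j _ => sub_nonneg.2 (hx j).2)
        fun j _ _ => sub_le_self _ (hx j).1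
    calc μ.real (A i ∩ avoid A S)
        ≤ μ.real (A i ∩ avoid A (S \ Γ i)) :=
          measureReal_mono (Set.inter_subset_inter_right _ (avoid_anti A sdiff_subset))
      _ ≤ x i * (∏ j ∈ Γ i, (1 - x j)) * μ.real (avoid A (S \ Γ i)) :=
          h i hi _ (sdiff_subset.trans hS) (fun hi => hiS (mem_sdiff.1 hi).1) disjoint_sdiff
      _ ≤ x i * ((∏ j ∈ Γ i ∩ S, (1 - x j)) * μ.real (avoid A (S \ Γ i))) := by
          rw [mul_assoc]
          gcongr
          exact (hx i).1
      _ ≤ x i * μ.real (avoid A S) := mul_le_mul_of_nonneg_left h_near (hx i).1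

theorem prod_one_sub_mul_measureReal_univ_le :
    (∏ i ∈ F, (1 - x i)) * μ.real Set.univ ≤ μ.real (avoid A F) := by
  classical
  simpa [avoid] using prod_one_sub_mul_measureReal_avoid_le (μ := μ) ∅ hA (fun i _ => (hx i).2)
    fun i hi U hU hiU => measureReal_inter_avoid_le hA hx h hi (by simpa using hU) (by simpa)

end LocalLemma

section RandomAssignment

variable {V : Type*}

theorem measure_inter_eq_mul_of_dependsOn {X : V → Type*} [∀ v, MeasurableSpace (X v)]
    [∀ v, Countable (X v)] [∀ v, MeasurableSingletonClass (X v)] (μ : ∀ v, Measure (X v))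
    [∀ v, IsProbabilityMeasure (μ v)] {I J : Finset V} (hIJ : Disjoint I J)
    {A B : Set (∀ v, X v)} (hA : DependsOn (· ∈ A) (I : Set V))
    (hB : DependsOn (· ∈ B) (J : Set V)) :
    Measure.infinitePi μ (A ∩ B) = Measure.infinitePi μ A * Measure.infinitePi μ B := by
  obtain ⟨A', hA'⟩ := dependsOn_iff_exists_comp.1 hA
  obtain ⟨B', hB'⟩ := dependsOn_iff_exists_comp.1 hB
  obtain rfl : A = (fun a (v : I) => a v) ⁻¹' {a | A' a} := Set.ext fun a => (congrFun hA' a).to_iff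
  obtain rfl : B = (fun a (v : J) => a v) ⁻¹' {a | B' a} := Set.ext fun a => (congrFun hB' a).to_iff
  have h_indep := (iIndepFun_infinitePi (P := μ) (X := fun _ => id)
    fun _ => measurable_id).indepFun_finset I J hIJ fun v => by fun_prop
  exact h_indep.measure_inter_preimage_eq_mul _ _ (Set.to_countable _).measurableSet
    (Set.to_countable _).measurableSet

/-- The uniform probability measure on assignments. -/
noncomputable def randomAssignment (V : Type*) : Measure (V → Bool) :=
  Measure.infinitePi fun _ => (PMF.uniformOfFintype Bool).toMeasure

instance : IsProbabilityMeasure (randomAssignment V) := by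
  unfold randomAssignment
  infer_instance

/-- The event that an assignment makes every literal of a clause false. -/
def violated (C : Clause V) : Set (V → Bool) := {a | ∀ p ∈ C, a p.1 ≠ p.2}

theorem mem_avoid_violated {a : V → Bool} {F : CNF V} :
    a ∈ avoid violated F ↔ Satisfies a F := by
  simp only [avoid, violated, Satisfies, Set.mem_iInter, Set.mem_compl_iff, Set.mem_ofPred_eq,
    ne_eq, not_forall, not_not, exists_prop]

theorem dependsOn_violated [DecidableEq V] (C : Clause V) :
    DependsOn (· ∈ violated C) (C.vars : Set V) := by
  intro a b h
  refine propext <| forall₂_congr fun p hp => ?_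
  rw [h p.1 (mem_image_of_mem _ hp)]

theorem dependsOn_avoid_violated [DecidableEq V] (F : CNF V) :
    DependsOn (· ∈ avoid violated F) (F.biUnion Clause.vars : Set V) := by
  intro a b h
  simp only [avoid, Set.mem_iInter]
  refine propext <| forall₂_congr fun C hC => not_congr ?_
  exact (dependsOn_violated C fun v hv => h v (mem_biUnion.2 ⟨C, hC, hv⟩)).to_iff

theorem violated_eq_pi [DecidableEq V] (C : Clause V) :
    violated C = (C.vars : Set V).pi fun v => {b | (v, b) ∉ C} := by
  ext a
  simp only [violated, Clause.vars, Set.mem_pi, coe_image, Set.forall_mem_image, mem_coe,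
    Set.mem_ofPred_eq]
  refine ⟨fun h p _ hap => h _ hap rfl, fun h p hp hap => h hp ?_⟩
  rwa [hap]

theorem measurableSet_violated (C : Clause V) : MeasurableSet (violated C) := by
  classical
  rw [violated_eq_pi]
  exact .pi (countable_toSet _) fun _ _ => (Set.to_countable _).measurableSet

theorem measureReal_coin_le (s : Finset Bool) :
    (PMF.uniformOfFintype Bool).toMeasure.real {b | b ∉ s} ≤ (2 ^ s.card)⁻¹ := by
  have h_compl : Fintype.card {b | b ∉ s} = 2 - s.card := by
    revert s; decide
  have h_card : s.card ≤ 2 := card_le_univ s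
  rw [measureReal_def, PMF.toMeasure_uniformOfFintype_apply _ (Set.to_countable _).measurableSet,
    h_compl]
  interval_cases s.card <;> norm_num

theorem measureReal_violated_le (C : Clause V) :
    (randomAssignment V).real (violated C) ≤ (2 ^ C.card)⁻¹ := by
  classical
  have h_fiber (v : V) : #{p ∈ C | p.1 = v} = #{b | (v, b) ∈ C} :=
    card_bij' (fun p _ => p.2) (fun b _ => (v, b)) (by grind) (by grind) (by grind) (by grind)
  rw [measureReal_def, randomAssignment, violated_eq_pi,
    Measure.infinitePi_pi _ fun _ _ => (Set.to_countable _).measurableSet, ENNReal.toReal_prod,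
    card_eq_sum_card_image Prod.fst C, ← prod_pow_eq_pow_sum, ← prod_inv_distrib]
  refine prod_le_prod (fun _ _ => ENNReal.toReal_nonneg) fun v _ => ?_
  simpa [h_fiber, measureReal_def] using measureReal_coin_le {b | (v, b) ∈ C}

theorem measureReal_violated_inter_avoid_le [DecidableEq V] {C : Clause V} {S : CNF V}
    (h : ∀ D ∈ S, Disjoint C.vars D.vars) :
    (randomAssignment V).real (violated C ∩ avoid violated S) ≤
      (2 ^ C.card)⁻¹ * (randomAssignment V).real (avoid violated S) := by
  rw [measureReal_def, randomAssignment, measure_inter_eq_mul_of_dependsOn _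
    ((disjoint_biUnion_right _ _ _).2 h) (dependsOn_violated C) (dependsOn_avoid_violated S),
    ENNReal.toReal_mul]
  exact mul_le_mul_of_nonneg_right (measureReal_violated_le C) measureReal_nonneg

end RandomAssignment

theorem satisfiable_of_inv_two_pow_le {V : Type*} [DecidableEq V] {F : CNF V} {k d : ℕ} {x : ℝ}
    (hF : IsKCNF k F) (hd : ∀ C ∈ F, (neighbors F C).card ≤ d) (hx₀ : 0 ≤ x) (hx₁ : x < 1)
    (hx : ((2 : ℝ) ^ k)⁻¹ ≤ x * (1 - x) ^ d) : Satisfiable F := by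
  have h_clause : ∀ C ∈ F, ∀ S ⊆ F, C ∉ S → Disjoint (neighbors F C) S →
      (randomAssignment V).real (violated C ∩ avoid violated S) ≤
        x * (∏ _D ∈ neighbors F C, (1 - x)) * (randomAssignment V).real (avoid violated S) := by
    intro C hC S hS hCS hdisj
    have h_disj : ∀ D ∈ S, Disjoint C.vars D.vars := by
      intro D hD
      by_contra h_inter
      rw [disjoint_iff_inter_eq_empty, ← ne_eq, ← nonempty_iff_ne_empty] at h_inter
      exact disjoint_right.1 hdisj hD
        (mem_filter.2 ⟨hS hD, ne_of_mem_of_not_mem hD hCS, h_inter⟩)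
    refine (measureReal_violated_inter_avoid_le h_disj).trans
      (mul_le_mul_of_nonneg_right ?_ measureReal_nonneg)
    rw [hF C hC, prod_const]
    exact hx.trans <| mul_le_mul_of_nonneg_left
      (pow_le_pow_of_le_one (by linarith) (by linarith) (hd C hC)) hx₀
  have h_pos : 0 < (randomAssignment V).real (avoid violated F) := by
    refine lt_of_lt_of_le ?_ (prod_one_sub_mul_measureReal_univ_le
      (fun C _ => measurableSet_violated C) (fun _ => ⟨hx₀, hx₁.le⟩) h_clause)
    rw [probReal_univ, mul_one]
    exact prod_pos fun _ _ => sub_pos.2 hx₁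
  obtain ⟨a, ha⟩ := nonempty_of_measure_ne_zero ((measureReal_ne_zero_iff).1 h_pos.ne')
  exact ⟨a, mem_avoid_violated.1 ha⟩

theorem admissible_zero {k : ℕ} (hk : 1 ≤ k) : Admissible k 0 := by
  intro F hF hd
  refine satisfiable_of_inv_two_pow_le hF hd (x := 1 / 2) (by norm_num) (by norm_num) ?_
  rw [pow_zero, mul_one, one_div]
  exact inv_anti₀ two_pos (le_self_pow₀ one_le_two (by omega))

theorem one_add_one_div_pow_le_exp (d : ℕ) : (1 + 1 / (d : ℝ)) ^ d ≤ Real.exp 1 := by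
  rcases Nat.eq_zero_or_pos d with rfl | hd
  · simp
  calc (1 + 1 / (d : ℝ)) ^ d ≤ Real.exp (1 / d) ^ d := by
        gcongr
        linarith [Real.add_one_le_exp (1 / (d : ℝ))]
    _ = Real.exp 1 := by
        rw [← Real.exp_nat_mul, mul_one_div_cancel (by positivity)]

theorem admissible_of_le_two_pow_div_exp {k d : ℕ} (hk : 1 ≤ k)
    (h : (d + 1 : ℝ) ≤ 2 ^ k / Real.exp 1) : Admissible k d := by
  rcases Nat.eq_zero_or_pos d with rfl | hd
  · exact admissible_zero hk
  intro F hF hF_nbrs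
  refine satisfiable_of_inv_two_pow_le hF hF_nbrs (x := 1 / (d + 1)) (by positivity)
    ((div_lt_one (by positivity)).2 (by simpa)) ?_
  have h_inv : (1 : ℝ) - 1 / (d + 1) = (1 + 1 / (d : ℝ))⁻¹ := by
    field_simp
    ring
  rw [h_inv, inv_pow, one_div, ← mul_inv]
  refine inv_anti₀ (by positivity) ?_
  rw [le_div_iff₀ (Real.exp_pos 1)] at h
  exact (mul_le_mul_of_nonneg_left (one_add_one_div_pow_le_exp d) (by positivity)).trans h

/-! ### Formulas of binary trees -/

/-- Proper binary trees. -/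
inductive BinTree
  | leaf : BinTree
  | node : BinTree → BinTree → BinTree

namespace BinTree

/-- The number of leaves of a tree at distance `i` from the root. -/
def leafCount : BinTree → ℕ → ℕ
  | leaf, 0 => 1
  | leaf, _ + 1 => 0
  | node _ _, 0 => 0
  | node T₁ T₂, i + 1 => leafCount T₁ i + leafCount T₂ i

/-- The number of leaves of a tree at distance less than `k` from the root. -/
def leavesWithin (T : BinTree) (k : ℕ) : ℕ := ∑ i ∈ range k, leafCount T i

@[simp]
theorem leavesWithin_zero (T : BinTree) : leavesWithin T 0 = 0 := rfl

@[simp]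
theorem leavesWithin_leaf_succ (k : ℕ) : leavesWithin leaf (k + 1) = 1 := by
  simp [leavesWithin, sum_range_succ', leafCount]

@[simp]
theorem leavesWithin_node_succ (T₁ T₂ : BinTree) (k : ℕ) :
    leavesWithin (node T₁ T₂) (k + 1) = leavesWithin T₁ k + leavesWithin T₂ k := by
  simp [leavesWithin, sum_range_succ', leafCount, sum_add_distrib]

theorem leavesWithin_leaf_le (k : ℕ) : leavesWithin leaf k ≤ 1 := by
  cases k <;> simp

/-- From every node of the tree at most `d` leaves are reachable by descending fewer than `k`
edges. -/
def Sparse (k d : ℕ) : BinTree → Prop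
  | leaf => leavesWithin leaf k ≤ d
  | node T₁ T₂ => leavesWithin (node T₁ T₂) k ≤ d ∧ Sparse k d T₁ ∧ Sparse k d T₂

theorem Sparse.leavesWithin_le {k d : ℕ} {T : BinTree} (h : Sparse k d T) :
    leavesWithin T k ≤ d := by
  cases T with
  | leaf => exact h
  | node => exact h.1

/-- The paths to the leaves of a tree hanging at the node with path `p`. Paths list the most recent
step first, so that the ancestors of a node are the suffixes of its path. -/
def leafPaths : BinTree → List Bool → Finset (List Bool)
  | leaf, p => {p}
  | node T₁ T₂, p => leafPaths T₁ (false :: p) ∪ leafPaths T₂ (true :: p)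

theorem suffix_of_mem_leafPaths {T : BinTree} {p q : List Bool} (h : q ∈ leafPaths T p) :
    p <:+ q := by
  induction T generalizing p with
  | leaf => simp [mem_singleton.1 h]
  | node T₁ T₂ ih₁ ih₂ =>
    rcases mem_union.1 h with h | h
    · exact (List.suffix_cons _ _).trans (ih₁ h)
    · exact (List.suffix_cons _ _).trans (ih₂ h)

theorem not_suffix_of_cons_suffix {b : Bool} {p q : List Bool} (h : b :: p <:+ q) :
    ¬ (!b) :: p <:+ q := by
  intro h'
  have := (List.suffix_of_suffix_length_le h h' (by simp)).eq_of_length (by simp)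
  simp at this

theorem disjoint_leafPaths (T₁ T₂ : BinTree) (p : List Bool) :
    Disjoint (leafPaths T₁ (false :: p)) (leafPaths T₂ (true :: p)) :=
  disjoint_left.2 fun _ h₁ h₂ =>
    not_suffix_of_cons_suffix (suffix_of_mem_leafPaths h₁) (suffix_of_mem_leafPaths h₂)

theorem card_filter_leafPaths (T : BinTree) (p : List Bool) (k : ℕ) :
    #{q ∈ leafPaths T p | q.length < p.length + k} = leavesWithin T k := by
  induction T generalizing p k with
  | leaf => cases k <;> simp [leafPaths, filter_singleton]
  | node T₁ T₂ ih₁ ih₂ =>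
    cases k with
    | zero =>
      rw [leavesWithin_zero, card_eq_zero, filter_eq_empty_iff]
      exact fun q hq => by simpa using (suffix_of_mem_leafPaths hq).length_le
    | succ k =>
      rw [leavesWithin_node_succ, ← ih₁ (false :: p), ← ih₂ (true :: p), leafPaths, filter_union,
        card_union_of_disjoint (disjoint_filter_filter (disjoint_leafPaths T₁ T₂ p))]
      simp only [List.length_cons, add_assoc, add_comm 1]

theorem Sparse.card_filter_root_le {k d : ℕ} {T : BinTree} (h : Sparse k d T) (p : List Bool) :
    #{q ∈ leafPaths T p | p <:+ q ∧ q.length < p.length + k} ≤ d :=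
  (card_le_card (monotone_filter_right _ fun _ _ h => h.2)).trans
    ((card_filter_leafPaths T p k).trans_le h.leavesWithin_le)

theorem exists_cons_suffix {p s : List Bool} (hs : p <:+ s) (hne : p ≠ s) : ∃ b, b :: p <:+ s := by
  obtain ⟨t, rfl⟩ := hs
  obtain rfl | ⟨t, b, rfl⟩ := t.eq_nil_or_concat'
  · simp at hne
  · exact ⟨b, t, by simp⟩

theorem Sparse.card_filter_le {k d : ℕ} {T : BinTree} (h : Sparse k d T) {p s : List Bool}
    (hs : p <:+ s) :
    #{q ∈ leafPaths T p | s <:+ q ∧ q.length < s.length + k} ≤ d := by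
  induction T generalizing p with
  | leaf =>
    rcases eq_or_ne p s with rfl | hne
    · exact h.card_filter_root_le p
    · rw [leafPaths, filter_singleton, if_neg fun h => hne (hs.eq_of_length_le h.1.length_le)]
      exact d.zero_le
  | node T₁ T₂ ih₁ ih₂ =>
    rcases eq_or_ne p s with rfl | hne
    · exact h.card_filter_root_le p
    · obtain ⟨b, hb⟩ := exists_cons_suffix hs hne
      rw [leafPaths, filter_union]
      cases b
      · have h_empty : {q ∈ leafPaths T₂ (true :: p) | s <:+ q ∧ q.length < s.length + k} = ∅ :=
          filter_false_of_mem fun q hq hsq =>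
            not_suffix_of_cons_suffix (hb.trans hsq.1) (suffix_of_mem_leafPaths hq)
        rw [h_empty, union_empty]
        exact ih₁ h.2.1 hb
      · have h_empty : {q ∈ leafPaths T₁ (false :: p) | s <:+ q ∧ q.length < s.length + k} = ∅ :=
          filter_false_of_mem fun q hq hsq =>
            not_suffix_of_cons_suffix (hb.trans hsq.1) (suffix_of_mem_leafPaths hq)
        rw [h_empty, empty_union]
        exact ih₂ h.2.2 hb

theorem exists_leafPath_follows (a : List Bool → Bool) (T : BinTree) {p : List Bool}
    (hp : ∀ b s, b :: s <:+ p → b = a s) :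
    ∃ q ∈ leafPaths T p, ∀ b s, b :: s <:+ q → b = a s := by
  induction T generalizing p with
  | leaf => exact ⟨p, mem_singleton_self p, hp⟩
  | node T₁ T₂ ih₁ ih₂ =>
    have h_step : ∀ b s, b :: s <:+ a p :: p → b = a s := by
      intro b s h
      rcases List.suffix_cons_iff.1 h with h | h
      · obtain ⟨rfl, rfl⟩ := List.cons.inj h
        rfl
      · exact hp b s h
    cases hap : a p <;> rw [hap] at h_step
    · obtain ⟨q, hq, h⟩ := ih₁ h_step
      exact ⟨q, mem_union_left _ hq, h⟩
    · obtain ⟨q, hq, h⟩ := ih₂ h_step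
      exact ⟨q, mem_union_right _ hq, h⟩

theorem exists_branching {T : BinTree} {p q q' : List Bool} (hq : q ∈ leafPaths T p)
    (hq' : q' ∈ leafPaths T p) (hne : q ≠ q') : ∃ b t, b :: t <:+ q ∧ (!b) :: t <:+ q' := by
  induction T generalizing p with
  | leaf => exact absurd ((mem_singleton.1 hq).trans (mem_singleton.1 hq').symm) hne
  | node T₁ T₂ ih₁ ih₂ =>
    rcases mem_union.1 hq with hq | hq <;> rcases mem_union.1 hq' with hq' | hq'
    · exact ih₁ hq hq'
    · exact ⟨false, p, suffix_of_mem_leafPaths hq, suffix_of_mem_leafPaths hq'⟩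
    · exact ⟨true, p, suffix_of_mem_leafPaths hq, suffix_of_mem_leafPaths hq'⟩
    · exact ih₂ hq hq'

end BinTree

open BinTree

/-- The clause read off the last `k` edges of a path. Its variables are the nodes of the tree; an
edge leaving the node `s` in direction `b` contributes the literal of `s` that fails when this
variable has value `b`. -/
def pathClause : ℕ → List Bool → Clause (List Bool)
  | 0, _ => ∅
  | _ + 1, [] => ∅
  | k + 1, b :: s => insert (s, !b) (pathClause k s)

theorem mem_pathClause {k : ℕ} {q s : List Bool} {b : Bool} :
    (s, b) ∈ pathClause k q ↔ (!b) :: s <:+ q ∧ q.length ≤ s.length + k := by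
  induction k generalizing q with
  | zero =>
    simp only [pathClause, notMem_empty, add_zero, false_iff, not_and, not_le]
    exact fun h => by simpa using h.length_le
  | succ k ih =>
    cases q with
    | nil => simp [pathClause]
    | cons c q =>
      rw [pathClause, mem_insert, ih, List.suffix_cons_iff]
      have : (!b) :: s <:+ q → s.length + 1 ≤ q.length := List.IsSuffix.length_le
      simp only [List.length_cons, List.cons.injEq, Prod.mk.injEq, Bool.not_eq_eq_eq_not]
      grind

theorem card_pathClause {k : ℕ} {q : List Bool} (h : k ≤ q.length) : #(pathClause k q) = k := by
  induction k generalizing q with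
  | zero => rfl
  | succ k ih =>
    cases q with
    | nil => simp at h
    | cons b s =>
      rw [pathClause, card_insert_of_notMem, ih (by simpa using h)]
      exact fun h_mem => by simpa using (mem_pathClause.1 h_mem).1.length_le

theorem exists_sibling_suffix {k : ℕ} {T : BinTree} {p q q' : List Bool}
    (hq : q ∈ leafPaths T p) (hq' : q' ∈ leafPaths T p) (hne : q ≠ q')
    (h : ((pathClause k q).vars ∩ (pathClause k q').vars).Nonempty) :
    ∃ x ∈ pathClause k q, x.2 :: x.1 <:+ q' ∧ q'.length < (x.2 :: x.1).length + k := by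
  obtain ⟨s, hs⟩ := h
  obtain ⟨hsq, hsq'⟩ := mem_inter.1 hs
  obtain ⟨⟨s, b⟩, hx, rfl⟩ := mem_image.1 hsq
  obtain ⟨⟨s', b'⟩, hx', rfl : s' = s⟩ := mem_image.1 hsq'
  obtain ⟨hb, hbl⟩ := mem_pathClause.1 hx
  obtain ⟨hb', hbl'⟩ := mem_pathClause.1 hx'
  obtain ⟨c, t, ht, ht'⟩ := exists_branching hq hq' hne
  have h_le : s'.length ≤ t.length := by
    -- Both paths pass through the node `s'`, so they separate at or below it.
    by_contra! h_lt
    have hs : s' <:+ q := (List.suffix_cons _ _).trans hb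
    have hs' : s' <:+ q' := (List.suffix_cons _ _).trans hb'
    exact not_suffix_of_cons_suffix (List.suffix_of_suffix_length_le ht hs h_lt)
      (List.suffix_of_suffix_length_le ht' hs' h_lt)
  refine ⟨(t, !c), mem_pathClause.2 ⟨by rwa [Bool.not_not], by omega⟩, ht', ?_⟩
  simp only [List.length_cons]
  omega

/-- The formula consisting of the `k`-clauses of the leaves of a tree. -/
def treeFormula (k : ℕ) (T : BinTree) : CNF (List Bool) := (leafPaths T []).image (pathClause k)

theorem not_satisfiable_treeFormula (k : ℕ) (T : BinTree) : ¬ Satisfiable (treeFormula k T) := by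
  rintro ⟨a, ha⟩
  obtain ⟨q, hq, h_follows⟩ := exists_leafPath_follows a T (p := []) (by simp)
  obtain ⟨⟨s, b⟩, hx, hab⟩ := ha _ (mem_image_of_mem _ hq)
  have := h_follows _ _ (mem_pathClause.1 hx).1
  simp [show a s = b from hab] at this

theorem isKCNF_treeFormula {k : ℕ} {T : BinTree} (h : leavesWithin T k = 0) :
    IsKCNF k (treeFormula k T) := by
  rw [← card_filter_leafPaths T [], card_eq_zero, filter_eq_empty_iff] at h
  exact forall_mem_image.2 fun q hq => card_pathClause (by simpa using h hq)

theorem card_neighbors_treeFormula_le {k d : ℕ} {T : BinTree} (hT : Sparse k d T)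
    {C : Clause (List Bool)} (hC : C ∈ treeFormula k T) (hk : #C = k) :
    #(neighbors (treeFormula k T) C) ≤ k * d := by
  obtain ⟨q, hq, rfl⟩ := mem_image.1 hC
  have h_sub : neighbors (treeFormula k T) (pathClause k q) ⊆ (pathClause k q).biUnion fun x =>
      {q' ∈ leafPaths T [] | x.2 :: x.1 <:+ q' ∧
        q'.length < (x.2 :: x.1).length + k}.image (pathClause k) := by
    intro D hD
    obtain ⟨hD, hne, h_inter⟩ := mem_filter.1 hD
    obtain ⟨q', hq', rfl⟩ := mem_image.1 hD
    obtain ⟨x, hx, h_sib⟩ := exists_sibling_suffix hq hq' (by grind) h_inter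
    exact mem_biUnion.2 ⟨x, hx, mem_image_of_mem _ (mem_filter.2 ⟨hq', h_sib⟩)⟩
  refine (card_le_card h_sub).trans ((card_biUnion_le_card_mul _ _ d fun x _ => ?_).trans_eq ?_)
  · exact card_image_le.trans (hT.card_filter_le List.nil_suffix)
  · rw [hk]

theorem not_admissible_of_sparse {k d : ℕ} {T : BinTree} (hT : Sparse k d T)
    (h : leavesWithin T k = 0) : ¬ Admissible k (k * d) := fun h_adm =>
  not_satisfiable_treeFormula k T <| h_adm.satisfiable (isKCNF_treeFormula h) fun C hC =>
    card_neighbors_treeFormula_le hT hC (isKCNF_treeFormula h C hC)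

namespace BinTree

theorem sparse_of_forall_leavesWithin_le {k d : ℕ} {T : BinTree}
    (h : ∀ m, leavesWithin T m ≤ d) : Sparse k d T := by
  induction T with
  | leaf => exact h k
  | node T₁ T₂ ih₁ ih₂ =>
    have h_add (m : ℕ) : leavesWithin T₁ m + leavesWithin T₂ m ≤ d := by
      rw [← leavesWithin_node_succ]
      exact h (m + 1)
    exact ⟨h k, ih₁ fun m => (Nat.le_add_right _ _).trans (h_add m),
      ih₂ fun m => (Nat.le_add_left _ _).trans (h_add m)⟩

/-- The complete binary tree of height `H` with the trees `f 0, …, f (2 ^ H - 1)` hanging at its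
leaves. -/
def complete : ℕ → (ℕ → BinTree) → BinTree
  | 0, f => f 0
  | H + 1, f => node (complete H f) (complete H fun v => f (2 ^ H + v))

theorem leafCount_complete_of_lt {H i : ℕ} (f : ℕ → BinTree) (hi : i < H) :
    leafCount (complete H f) i = 0 := by
  induction H generalizing f i with
  | zero => simp at hi
  | succ H ih =>
    cases i with
    | zero => rfl
    | succ i => simp [complete, leafCount, ih _ (Nat.lt_of_succ_lt_succ hi)]

theorem leafCount_complete (H i : ℕ) (f : ℕ → BinTree) :
    leafCount (complete H f) (i + H) = ∑ v ∈ range (2 ^ H), leafCount (f v) i := by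
  induction H generalizing f with
  | zero => simp [complete]
  | succ H ih => rw [complete, ← add_assoc, leafCount, ih, ih, pow_succ, mul_two, sum_range_add]

theorem leavesWithin_complete (k H : ℕ) (f : ℕ → BinTree) :
    leavesWithin (complete H f) k = ∑ v ∈ range (2 ^ H), leavesWithin (f v) (k - H) := by
  induction H generalizing k f with
  | zero => simp [complete]
  | succ H ih =>
    cases k with
    | zero => simp
    | succ k =>
      rw [complete, leavesWithin_node_succ, ih, ih, pow_succ, mul_two, sum_range_add,
        Nat.add_sub_add_right]

theorem sparse_complete {k d H : ℕ} {f : ℕ → BinTree} (hf : ∀ v, Sparse k d (f v))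
    (h : ∀ j ≤ H, ∀ o, ∑ v ∈ range (2 ^ j), leavesWithin (f (o + v)) (k - j) ≤ d) :
    Sparse k d (complete H f) := by
  induction H generalizing f with
  | zero => exact hf 0
  | succ H ih =>
    refine ⟨?_, ih hf fun j hj => h j (hj.trans H.le_succ),
      ih (fun v => hf _) fun j hj o => ?_⟩
    · rw [← complete, leavesWithin_complete]
      simpa only [zero_add] using h (H + 1) le_rfl 0
    · simpa only [add_assoc] using h j (hj.trans H.le_succ) (2 ^ H + o)

/-- The tree with every leaf replaced by a node with two leaves. This turns the construction for
`k` into one for `k + 1`. -/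
def grow : BinTree → BinTree
  | leaf => node leaf leaf
  | node T₁ T₂ => node (grow T₁) (grow T₂)

theorem leavesWithin_grow_succ (T : BinTree) (k : ℕ) :
    leavesWithin (grow T) (k + 1) = 2 * leavesWithin T k := by
  induction T generalizing k with
  | leaf => rw [grow, leavesWithin_node_succ, two_mul]
  | node T₁ T₂ ih₁ ih₂ =>
    rw [grow, leavesWithin_node_succ]
    cases k with
    | zero => simp
    | succ k => rw [ih₁, ih₂, leavesWithin_node_succ, mul_add]

theorem sparse_grow {k d : ℕ} {T : BinTree} (hd : 0 < d) (h : Sparse k d T) :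
    Sparse (k + 1) (2 * d) (grow T) := by
  induction T with
  | leaf =>
    have h_leaf : leavesWithin leaf (k + 1) ≤ 2 * d := by
      rw [leavesWithin_leaf_succ]
      omega
    refine ⟨?_, h_leaf, h_leaf⟩
    change leavesWithin (grow leaf) (k + 1) ≤ 2 * d
    rw [leavesWithin_grow_succ]
    exact Nat.mul_le_mul_left 2 h
  | node T₁ T₂ ih₁ ih₂ =>
    refine ⟨?_, ih₁ h.2.1, ih₂ h.2.2⟩
    change leavesWithin (grow (node T₁ T₂)) (k + 1) ≤ 2 * d
    rw [leavesWithin_grow_succ]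
    exact Nat.mul_le_mul_left 2 h.1

theorem exists_sparse_add {k d : ℕ} {T : BinTree} (hd : 0 < d) (hT : Sparse k d T)
    (h : leavesWithin T k = 0) (r : ℕ) :
    ∃ T', Sparse (k + r) (2 ^ r * d) T' ∧ leavesWithin T' (k + r) = 0 := by
  induction r with
  | zero => exact ⟨T, by simpa using hT, h⟩
  | succ r ih =>
    obtain ⟨T', hT', h'⟩ := ih
    refine ⟨grow T', ?_, by rw [← add_assoc, leavesWithin_grow_succ, h', mul_zero]⟩
    rw [pow_succ', mul_assoc]
    exact sparse_grow (by positivity) hT'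

end BinTree

theorem not_admissible_mul_two_pow (k : ℕ) : ¬ Admissible k (k * 2 ^ k) := by
  refine not_admissible_of_sparse (T := complete k fun _ => leaf)
    (sparse_complete (fun _ => (leavesWithin_leaf_le k).trans Nat.one_le_two_pow) fun j hj _ => ?_)
    (by simp [leavesWithin_complete])
  calc ∑ _ ∈ range (2 ^ j), leavesWithin leaf (k - j) ≤ ∑ _ ∈ range (2 ^ j), 1 :=
        sum_le_sum fun _ _ => leavesWithin_leaf_le _
    _ = 2 ^ j := by simp
    _ ≤ 2 ^ k := Nat.pow_le_pow_right two_pos hj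

theorem Admissible.mono {k d d' : ℕ} (h : Admissible k d) (hle : d' ≤ d) : Admissible k d' :=
  fun F hF hN => h F hF fun C hC => (hN C hC).trans hle

theorem Admissible.lt_of_not {k d d' : ℕ} (h : Admissible k d) (h' : ¬ Admissible k d') : d < d' :=
  lt_of_not_ge fun hle => h' (h.mono hle)

theorem isGreatest_l {k : ℕ} (hk : 1 ≤ k) : IsGreatest {d : ℕ | Admissible k d} (l k) := by
  have h_bdd : BddAbove {d : ℕ | Admissible k d} :=
    ⟨k * 2 ^ k, fun d hd => (Admissible.lt_of_not hd (not_admissible_mul_two_pow k)).le⟩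
  exact ⟨Nat.sSup_mem ⟨0, admissible_zero hk⟩ h_bdd, fun d hd => le_csSup h_bdd hd⟩

theorem floor_two_pow_div_exp_sub_one_le_l {k : ℕ} (hk : 1 ≤ k) :
    ⌊(2 : ℝ) ^ k / Real.exp 1⌋ - 1 ≤ (l k : ℤ) := by
  rcases lt_or_ge (⌊(2 : ℝ) ^ k / Real.exp 1⌋ - 1) 0 with h | h
  · exact h.le.trans (Int.natCast_nonneg _)
  · obtain ⟨d, hd⟩ := Int.eq_ofNat_of_zero_le h
    have h_le : (d + 1 : ℝ) ≤ 2 ^ k / Real.exp 1 := by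
      have h_floor : (d : ℤ) + 1 = ⌊(2 : ℝ) ^ k / Real.exp 1⌋ := by omega
      exact_mod_cast Int.le_floor.1 h_floor.le
    rw [hd]
    exact_mod_cast (isGreatest_l hk).2 (admissible_of_le_two_pow_div_exp hk h_le)

/-! ### Construction of sparse trees -/

theorem sum_range_ite_lt {α M : Type*} [AddCommMonoid M] {a N : ℕ} (h : a ≤ N) (F : α → M)
    (f : ℕ → α) (t : α) :
    ∑ v ∈ range N, F (if v < a then f v else t) = ∑ v ∈ range a, F (f v) + (N - a) • F t := by
  rw [← sum_range_add_sum_Ico _ h]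
  congr 1
  · exact sum_congr rfl fun v hv => by rw [if_pos (mem_range.1 hv)]
  · rw [sum_congr rfl fun v hv => by rw [if_neg (mem_Ico.1 hv).1.not_gt], sum_const, Nat.card_Ico]

namespace BinTree

theorem exists_forest {n N : ℕ} {x : ℕ → ℕ} (h : (N : ℝ) ≤ ∑ i ∈ range n, (x i : ℝ) / 2 ^ i) :
    ∃ f : ℕ → BinTree, ∀ i, ∑ v ∈ range N, leafCount (f v) i ≤ x i := by
  induction n generalizing N x with
  | zero =>
    obtain rfl : N = 0 := by simpa using h
    exact ⟨fun _ => leaf, by simp⟩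
  | succ n ih =>
    have h_next : ((N - x 0 + (N - x 0) : ℕ) : ℝ) ≤ ∑ i ∈ range n, (x (i + 1) : ℝ) / 2 ^ i := by
      have h_half : ∑ i ∈ range n, (x (i + 1) : ℝ) / 2 ^ (i + 1)
          = (∑ i ∈ range n, (x (i + 1) : ℝ) / 2 ^ i) / 2 := by
        rw [sum_div]
        exact sum_congr rfl fun i _ => by rw [pow_succ, div_div]
      rw [sum_range_succ', h_half, pow_zero, div_one] at h
      have h_nonneg : 0 ≤ ∑ i ∈ range n, (x (i + 1) : ℝ) / 2 ^ i := by positivity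
      rcases le_total N (x 0) with h_le | h_le
      · simpa [Nat.sub_eq_zero_of_le h_le] using h_nonneg
      · rw [Nat.cast_add, Nat.cast_sub h_le]
        linarith
    obtain ⟨f, hf⟩ := ih h_next
    refine ⟨fun v => if v < N - x 0 then node (f v) (f (N - x 0 + v)) else leaf, fun i => ?_⟩
    rw [sum_range_ite_lt (N.sub_le (x 0)) (leafCount · i) fun v => node (f v) (f (N - x 0 + v))]
    cases i with
    | zero =>
      simp only [leafCount, sum_const_zero, smul_eq_mul]
      omega
    | succ i =>
      simp only [leafCount, smul_zero, add_zero, sum_add_distrib]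
      exact (sum_range_add _ _ _).symm.trans_le (hf i)

/-- The surplus `2` compensates for rounding the counts `y i` down. -/
theorem exists_forest_of_real {n N : ℕ} {y : ℕ → ℝ} (hy : ∀ i, 0 ≤ y i)
    (h : (N : ℝ) + 2 ≤ ∑ i ∈ range n, y i / 2 ^ i) :
    ∃ f : ℕ → BinTree, (∀ i, ∑ v ∈ range N, (leafCount (f v) i : ℝ) ≤ if i < n then y i else 0) ∧
      ∀ m, ∑ v ∈ range N, (leavesWithin (f v) m : ℝ) ≤ ∑ i ∈ range n, y i := by
  have h_round : (N : ℝ) ≤ ∑ i ∈ range n, ((if i < n then ⌊y i⌋₊ else 0 : ℕ) : ℝ) / 2 ^ i := by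
    have h_term : ∀ i ∈ range n,
        y i / 2 ^ i ≤ ((if i < n then ⌊y i⌋₊ else 0 : ℕ) : ℝ) / 2 ^ i + (1 / 2) ^ i := by
      intro i hi
      rw [if_pos (mem_range.1 hi), one_div_pow, ← add_div]
      gcongr
      exact (Nat.lt_floor_add_one _).le
    have h_sum := sum_le_sum h_term
    rw [sum_add_distrib] at h_sum
    linarith [sum_geometric_two_le n]
  obtain ⟨f, hf⟩ := exists_forest h_round
  refine ⟨f, fun i => ?_, fun m => ?_⟩
  · calc ∑ v ∈ range N, (leafCount (f v) i : ℝ) ≤ (if i < n then ⌊y i⌋₊ else 0 : ℕ) := by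
          exact_mod_cast hf i
      _ ≤ if i < n then y i else 0 := by
          split_ifs
          · exact Nat.floor_le (hy i)
          · simp
  · have h_nat : ∑ v ∈ range N, leavesWithin (f v) m ≤ ∑ i ∈ range n, ⌊y i⌋₊ := by
      calc ∑ v ∈ range N, leavesWithin (f v) m
          = ∑ i ∈ range m, ∑ v ∈ range N, leafCount (f v) i := sum_comm
        _ ≤ ∑ i ∈ range m, if i < n then ⌊y i⌋₊ else 0 := sum_le_sum fun i _ => hf i
        _ = ∑ i ∈ range m with i < n, ⌊y i⌋₊ := (sum_filter _ _).symm
        _ ≤ ∑ i ∈ range n, ⌊y i⌋₊ :=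
          sum_le_sum_of_subset fun i hi => mem_range.2 (mem_filter.1 hi).2
    calc ∑ v ∈ range N, (leavesWithin (f v) m : ℝ) ≤ ∑ i ∈ range n, (⌊y i⌋₊ : ℝ) := by
          exact_mod_cast h_nat
      _ ≤ ∑ i ∈ range n, y i := sum_le_sum fun i _ => Nat.floor_le (hy i)

end BinTree

theorem sparse_complete_ite {k d H a : ℕ} {f : ℕ → BinTree} {T : BinTree} (hT : Sparse k d T)
    (h : ∀ j ≤ H, ∀ m,
      ∑ v ∈ range a, leavesWithin (f v) m + 2 ^ j * leavesWithin T (k - j) ≤ d) :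
    Sparse k d (complete H fun v => if v < a then f v else T) := by
  refine sparse_complete (fun v => ?_) fun j hj o => ?_
  · rcases lt_or_ge v a with hv | hv
    · rw [if_pos hv]
      refine sparse_of_forall_leavesWithin_le fun m => ?_
      calc leavesWithin (f v) m ≤ ∑ v ∈ range a, leavesWithin (f v) m :=
            single_le_sum_of_canonicallyOrdered (f := fun v => leavesWithin (f v) m)
              (mem_range.2 hv)
        _ ≤ d := (Nat.le_add_right _ _).trans (h 0 H.zero_le m)
    · rwa [if_neg hv.not_gt]
  · let F (v : ℕ) : ℕ := if v < a then leavesWithin (f v) (k - j) else 0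
    have h_F : ∑ v ∈ range (2 ^ j), F (o + v) ≤ ∑ v ∈ range a, leavesWithin (f v) (k - j) := by
      calc ∑ v ∈ range (2 ^ j), F (o + v) ≤ ∑ v ∈ range (o + 2 ^ j), F v := by
            rw [sum_range_add]
            exact Nat.le_add_left _ _
        _ = ∑ v ∈ range (o + 2 ^ j) with v < a, leavesWithin (f v) (k - j) := (sum_filter _ _).symm
        _ ≤ ∑ v ∈ range a, leavesWithin (f v) (k - j) :=
          sum_le_sum_of_subset fun v hv => mem_range.2 (mem_filter.1 hv).2
    calc ∑ v ∈ range (2 ^ j), leavesWithin (if o + v < a then f (o + v) else T) (k - j)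
        ≤ ∑ v ∈ range (2 ^ j), (F (o + v) + leavesWithin T (k - j)) := by
          refine sum_le_sum fun v _ => ?_
          simp only [F]
          split_ifs <;> simp
      _ = ∑ v ∈ range (2 ^ j), F (o + v) + 2 ^ j * leavesWithin T (k - j) := by
          rw [sum_add_distrib, sum_const, card_range, smul_eq_mul]
      _ ≤ d := (Nat.add_le_add_right h_F _).trans (h j hj _)

/-- There is a sparse tree with at most `x i` leaves at every distance `i < k` from the root. -/
def Constructible (k d : ℕ) (x : ℕ → ℝ) : Prop :=
  ∃ T : BinTree, Sparse k d T ∧ ∀ i < k, (leafCount T i : ℝ) ≤ x i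

/-- The number of leaves allowed at distance `i < R * (M + 2)` from a node, in a construction that
descends `R` levels per generation and finishes some of the nodes after each generation. Here `u m`
is the fraction of nodes of generation `m` that are unfinished, and the node is an unfinished one of
generation `n + M + 1`. The leaves at distance `i` are allotted to the unfinished nodes of
generation `n + i / R` with density `β`; when some of these get finished, their shares pass to the
others, whence the quotient. -/
noncomputable def profile (β : ℝ) (R M : ℕ) (u : ℕ → ℝ) (n i : ℕ) : ℝ :=
  if i < R then 0 else β * 2 ^ i * (u (n + i / R) / u (n + M + 1))

theorem sum_range_two_pow_le (m : ℕ) : ∑ i ∈ range m, (2 : ℝ) ^ i ≤ 2 ^ m := by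
  rw [geom_sum_eq (by norm_num)]
  norm_num

theorem sum_range_mul_div {S : Type*} [Semiring S] {R : ℕ} (hR : 0 < R) (m : ℕ) (φ : ℕ → S) :
    ∑ i ∈ range (R * m), φ (i / R) = R * ∑ j ∈ range m, φ j := by
  induction m with
  | zero => simp
  | succ m ih =>
    have h_block : ∀ i ∈ range R, φ ((R * m + i) / R) = φ m := fun i hi => by
      rw [Nat.mul_add_div hR, Nat.div_eq_of_lt (mem_range.1 hi), add_zero]
    rw [mul_add, mul_one, sum_range_add, ih, sum_range_succ, mul_add, sum_congr rfl h_block,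
      sum_const, card_range, nsmul_eq_mul]

section Profile

variable {d R M n : ℕ} {β γ : ℝ} {u : ℕ → ℝ}

theorem profile_nonneg (hβ : 0 ≤ β) (hu₀ : ∀ m, 0 < u m) (n i : ℕ) :
    0 ≤ profile β R M u n i := by
  have := hu₀ (n + i / R)
  have := hu₀ (n + M + 1)
  unfold profile
  positivity

theorem profile_add (hR : 0 < R) (i : ℕ) :
    profile β R M u n (i + R) = β * 2 ^ (i + R) * (u (n + 1 + i / R) / u (n + M + 1)) := by
  rw [profile, if_neg (by omega), Nat.add_div_right i hR, ← add_assoc, add_right_comm]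

theorem sum_profile_add_div (hR : 0 < R) :
    ∑ i ∈ range R, profile β R M u n (i + R) / 2 ^ i =
      R * β * 2 ^ R * (u (n + 1) / u (n + M + 1)) := by
  have h_term : ∀ i ∈ range R, profile β R M u n (i + R) / 2 ^ i =
      β * 2 ^ R * (u (n + 1) / u (n + M + 1)) := fun i hi => by
    rw [profile_add hR, Nat.div_eq_of_lt (mem_range.1 hi), add_zero, pow_add]
    field_simp
  rw [sum_congr rfl h_term, sum_const, card_range, nsmul_eq_mul]
  ring

theorem sum_profile_div (hR : 0 < R) :
    ∑ i ∈ range (R * (M + 2)), profile β R M u n i / 2 ^ i =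
      R * β * ∑ j ∈ range (M + 1), u (n + 1 + j) / u (n + M + 1) := by
  have h_zero : ∀ i ∈ range R, profile β R M u n i / 2 ^ i = 0 := fun i hi => by
    rw [profile, if_pos (mem_range.1 hi), zero_div]
  have h_term (i : ℕ) : profile β R M u n (R + i) / 2 ^ (R + i) =
      β * (u (n + 1 + i / R) / u (n + M + 1)) := by
    rw [add_comm R, profile_add hR]
    field_simp
  rw [show R * (M + 2) = R + R * (M + 1) by ring, sum_range_add, sum_eq_zero h_zero, zero_add]
  simp only [h_term]
  rw [sum_range_mul_div hR _ fun j => β * (u (n + 1 + j) / u (n + M + 1)), ← mul_sum, mul_assoc]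

theorem profile_le (hR : 0 < R) (hβ : 0 ≤ β) (hγ : 0 ≤ γ) (hu₀ : ∀ m, 0 < u m)
    (hu : ∀ m j : ℕ, u m ≤ u (m + j) * Real.exp (γ * j)) {i : ℕ} (hi : i < R * (M + 2)) :
    profile β R M u n i ≤
      β * 2 ^ i * (Real.exp γ + if i < R * M then Real.exp (γ * M) else 0) := by
  have h_ratio {j s : ℕ} (hj : n + j + s = n + M + 1) :
      u (n + j) / u (n + M + 1) ≤ Real.exp (γ * s) := by
    rw [div_le_iff₀' (hu₀ _), ← hj]
    exact hu _ _
  have h_exp {s t : ℕ} (hst : s ≤ t) : Real.exp (γ * s) ≤ Real.exp (γ * t) := by gcongr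
  have h_top : i / R < M + 2 := Nat.div_lt_of_lt_mul hi
  rw [profile]
  split_ifs with h₁ h₂ h₂
  · positivity
  · positivity
  · have h_one : 1 ≤ i / R := (Nat.one_le_div_iff hR).2 (not_lt.1 h₁)
    gcongr
    calc u (n + i / R) / u (n + M + 1) ≤ Real.exp (γ * (M + 1 - i / R : ℕ)) :=
          h_ratio (by omega)
      _ ≤ Real.exp (γ * M) := h_exp (by omega)
      _ ≤ Real.exp γ + Real.exp (γ * M) := le_add_of_nonneg_left (Real.exp_nonneg _)
  · have h_M : M ≤ i / R := (Nat.le_div_iff_mul_le hR).2 (by linarith)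
    gcongr
    calc u (n + i / R) / u (n + M + 1) ≤ Real.exp (γ * (M + 1 - i / R : ℕ)) :=
          h_ratio (by omega)
      _ ≤ Real.exp (γ * (1 : ℕ)) := h_exp (by omega)
      _ = Real.exp γ + 0 := by simp

theorem two_pow_mul_sum_profile_le (hR : 0 < R) (hβ : 0 ≤ β) (hγ : 0 ≤ γ) (hu₀ : ∀ m, 0 < u m)
    (hu : ∀ m j : ℕ, u m ≤ u (m + j) * Real.exp (γ * j)) {h : ℕ} (hh : h ≤ R) :
    2 ^ h * ∑ i ∈ range (R * (M + 2) - h), profile β R M u n i ≤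
      β * 2 ^ (R * (M + 2)) * (Real.exp γ + Real.exp (γ * M) / 2 ^ R) := by
  set m := R * (M + 2) - h
  have hm : h + m = R * (M + 2) := Nat.add_sub_cancel' (by nlinarith)
  have h_old : ∑ i ∈ range m, (if i < R * M then (2 : ℝ) ^ i else 0) ≤ 2 ^ (R * M) := by
    rw [← sum_filter]
    refine (sum_le_sum_of_subset_of_nonneg (fun i hi => ?_) fun _ _ _ => by positivity).trans
      (sum_range_two_pow_le (R * M))
    exact mem_range.2 (mem_filter.1 hi).2
  calc 2 ^ h * ∑ i ∈ range m, profile β R M u n i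
      ≤ 2 ^ h * ∑ i ∈ range m,
          β * 2 ^ i * (Real.exp γ + if i < R * M then Real.exp (γ * M) else 0) := by
        gcongr with i hi
        exact profile_le hR hβ hγ hu₀ hu (by have := mem_range.1 hi; omega)
    _ = β * (2 ^ h * (∑ i ∈ range m, 2 ^ i) * Real.exp γ +
          2 ^ h * (∑ i ∈ range m, if i < R * M then 2 ^ i else 0) * Real.exp (γ * M)) := by
        simp only [mul_sum, sum_mul, ← sum_add_distrib]
        refine sum_congr rfl fun i _ => ?_
        split_ifs <;> ring
    _ ≤ β * (2 ^ h * 2 ^ m * Real.exp γ + 2 ^ R * 2 ^ (R * M) * Real.exp (γ * M)) := by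
        gcongr
        · exact sum_range_two_pow_le m
        · exact one_le_two
    _ = β * 2 ^ (R * (M + 2)) * (Real.exp γ + Real.exp (γ * M) / 2 ^ R) := by
        rw [← pow_add, hm, show R * (M + 2) = R * M + R + R by ring, pow_add, pow_add]
        field_simp

theorem sum_profile_add_le (hR : 0 < R) (hM : 1 ≤ M) (hβ : 0 ≤ β)
    (hu₀ : ∀ m, 0 < u m) (hu : ∀ m j : ℕ, u m ≤ u (m + j) * Real.exp (γ * j)) :
    ∑ i ∈ range R, profile β R M u n (i + R) ≤
      β * 2 ^ (R * (M + 2)) * (Real.exp (γ * M) / 2 ^ R) := by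
  calc ∑ i ∈ range R, profile β R M u n (i + R)
      ≤ ∑ i ∈ range R, β * 2 ^ (i + R) * Real.exp (γ * M) := by
        refine sum_le_sum fun i hi => ?_
        rw [profile_add hR, Nat.div_eq_of_lt (mem_range.1 hi), add_zero]
        gcongr
        rw [div_le_iff₀' (hu₀ _), add_right_comm]
        exact hu _ _
    _ = β * ((∑ i ∈ range R, 2 ^ i) * 2 ^ R) * Real.exp (γ * M) := by
        simp only [pow_add, sum_mul, mul_sum]
    _ ≤ β * (2 ^ R * 2 ^ R) * Real.exp (γ * M) := by
        gcongr
        exact sum_range_two_pow_le R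
    _ ≤ β * (2 ^ (R * (M + 2)) / 2 ^ R) * Real.exp (γ * M) := by
        gcongr
        rw [le_div_iff₀ (by positivity), ← pow_add, ← pow_add]
        exact pow_le_pow_right₀ one_le_two (by nlinarith)
    _ = β * 2 ^ (R * (M + 2)) * (Real.exp (γ * M) / 2 ^ R) := by ring

theorem leavesWithin_le_sum {k m : ℕ} {T : BinTree} {x : ℕ → ℝ}
    (hT : ∀ i < k, (leafCount T i : ℝ) ≤ x i) (hm : m ≤ k) :
    (leavesWithin T m : ℝ) ≤ ∑ i ∈ range m, x i := by
  rw [leavesWithin, Nat.cast_sum]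
  exact sum_le_sum fun i hi => hT i ((mem_range.1 hi).trans_le hm)

theorem two_pow_sub_mul_profile_succ (hR : 0 < R) (hu₀ : ∀ m, 0 < u m) {a : ℕ}
    (hu_succ : u (n + M + 2) = u (n + M + 1) * (1 - a / 2 ^ R)) (i : ℕ) :
    (2 ^ R - a) * profile β R M u (n + 1) i = if i < R then 0 else profile β R M u n (i + R) := by
  rw [profile_add hR, profile, show n + 1 + M + 1 = n + M + 2 by ring]
  split_ifs
  · exact mul_zero _
  · rw [one_sub_div (by positivity)] at hu_succ
    have h_sub : (2 ^ R - a : ℝ) ≠ 0 :=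
      (div_ne_zero_iff.1 (right_ne_zero_of_mul (hu_succ ▸ (hu₀ (n + M + 2)).ne'))).1
    rw [hu_succ, pow_add]
    field_simp

theorem constructible_profile_of_succ (hR : 0 < R) (hM : 1 ≤ M) (hβ : 0 ≤ β) (hγ : 0 ≤ γ)
    (hu₀ : ∀ m, 0 < u m) (hu : ∀ m j : ℕ, u m ≤ u (m + j) * Real.exp (γ * j))
    (hd : β * 2 ^ (R * (M + 2)) * (Real.exp γ + 2 * (Real.exp (γ * M) / 2 ^ R)) ≤ d) {a : ℕ}
    (hu_succ : u (n + M + 2) = u (n + M + 1) * (1 - a / 2 ^ R))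
    (h_kraft : (a : ℝ) + 2 ≤ R * β * 2 ^ R * (u (n + 1) / u (n + M + 1)))
    (h : Constructible (R * (M + 2)) d (profile β R M u (n + 1))) :
    Constructible (R * (M + 2)) d (profile β R M u n) := by
  obtain ⟨T, hT, hT_count⟩ := h
  have ha : a ≤ 2 ^ R := by
    have h_pos := pos_of_mul_pos_right (hu_succ ▸ hu₀ _) (hu₀ (n + M + 1)).le
    rw [sub_pos, div_lt_one (by positivity)] at h_pos
    exact_mod_cast h_pos.le
  obtain ⟨f, hf_count, hf_within⟩ :=
    exists_forest_of_real (fun i => profile_nonneg hβ hu₀ n (i + R))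
      (h_kraft.trans_eq (sum_profile_add_div hR).symm)
  refine ⟨complete R fun v => if v < a then f v else T,
    sparse_complete_ite hT fun j hj m => ?_, fun i hi => ?_⟩
  · have h_T : (2 : ℝ) ^ j * leavesWithin T (R * (M + 2) - j) ≤
        β * 2 ^ (R * (M + 2)) * (Real.exp γ + Real.exp (γ * M) / 2 ^ R) :=
      (mul_le_mul_of_nonneg_left (leavesWithin_le_sum hT_count (Nat.sub_le _ _))
        (by positivity)).trans (two_pow_mul_sum_profile_le hR hβ hγ hu₀ hu hj)
    have h_f := (hf_within m).trans (sum_profile_add_le hR hM hβ hu₀ hu)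
    have h_real : ∑ v ∈ range a, (leavesWithin (f v) m : ℝ) +
        2 ^ j * leavesWithin T (R * (M + 2) - j) ≤ d := by linarith
    exact_mod_cast h_real
  · rcases lt_or_ge i R with h_lt | h_ge
    · rw [leafCount_complete_of_lt _ h_lt]
      exact_mod_cast profile_nonneg hβ hu₀ n i
    · obtain ⟨i, rfl⟩ := Nat.exists_eq_add_of_le' h_ge
      rw [leafCount_complete, sum_range_ite_lt ha (leafCount · i)]
      push_cast [smul_eq_mul, Nat.cast_sub ha]
      calc ∑ v ∈ range a, (leafCount (f v) i : ℝ) + (2 ^ R - a) * leafCount T i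
          ≤ (if i < R then profile β R M u n (i + R) else 0) +
              (2 ^ R - a) * profile β R M u (n + 1) i := by
            have ha' : (0 : ℝ) ≤ 2 ^ R - a := sub_nonneg.2 (by exact_mod_cast ha)
            gcongr
            · exact hf_count i
            · exact hT_count i (by omega)
        _ = profile β R M u n (i + R) := by
            rw [two_pow_sub_mul_profile_succ hR hu₀ hu_succ]
            split_ifs <;> simp

theorem constructible_profile_of_le_sum (hR : 0 < R) (hβ : 0 ≤ β) (hγ : 0 ≤ γ)
    (hu₀ : ∀ m, 0 < u m) (hu : ∀ m j : ℕ, u m ≤ u (m + j) * Real.exp (γ * j))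
    (hd : β * 2 ^ (R * (M + 2)) * (Real.exp γ + 2 * (Real.exp (γ * M) / 2 ^ R)) ≤ d)
    (h_kraft : 3 ≤ R * β * ∑ j ∈ range (M + 1), u (n + 1 + j) / u (n + M + 1)) :
    Constructible (R * (M + 2)) d (profile β R M u n) := by
  obtain ⟨f, hf_count, hf_within⟩ :=
    exists_forest_of_real (N := 1) (profile_nonneg (M := M) hβ hu₀ n) <| by
      rw [sum_profile_div hR]
      norm_num [h_kraft]
  refine ⟨f 0, sparse_of_forall_leavesWithin_le fun m => ?_, fun i hi => ?_⟩
  · have h_le := two_pow_mul_sum_profile_le (M := M) (n := n) hR hβ hγ hu₀ hu R.zero_le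
    have h_within := hf_within m
    have h_nonneg : 0 ≤ β * 2 ^ (R * (M + 2)) * (Real.exp (γ * M) / 2 ^ R) := by positivity
    rw [pow_zero, one_mul, Nat.sub_zero] at h_le
    rw [sum_range_one] at h_within
    have h_real : (leavesWithin (f 0) m : ℝ) ≤ d := by linarith
    exact_mod_cast h_real
  · have h_count := hf_count i
    rwa [sum_range_one, if_pos hi] at h_count

theorem exists_sparse_of_constructible_profile {k : ℕ} (hβ : 0 ≤ β)
    (hu : ∀ m ≤ n + M + 1, u m = 1) (hk : k = R * (M + 2)) (hd : β * 2 ^ k ≤ d)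
    (h : Constructible k d (profile β R M u n)) :
    ∃ T, Sparse k d T ∧ leavesWithin T k = 0 := by
  obtain ⟨T, hT, hT_count⟩ := h
  have h_within {m : ℕ} (hm : m ≤ k) : (leavesWithin T m : ℝ) ≤ β * 2 ^ m := by
    calc (leavesWithin T m : ℝ) ≤ ∑ i ∈ range m, profile β R M u n i :=
          leavesWithin_le_sum hT_count hm
      _ ≤ ∑ i ∈ range m, β * 2 ^ i := by
          refine sum_le_sum fun i hi => ?_
          have h_div : i / R < M + 2 :=
            Nat.div_lt_of_lt_mul (hk ▸ (mem_range.1 hi).trans_le hm)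
          rw [profile, hu (n + i / R) (by omega), hu _ le_rfl, div_one, mul_one]
          split_ifs
          · positivity
          · exact le_rfl
      _ ≤ β * 2 ^ m := by
          rw [← mul_sum]
          exact mul_le_mul_of_nonneg_left (sum_range_two_pow_le m) hβ
  refine ⟨complete k fun _ => T, sparse_complete (fun _ => hT) fun j hj _ => ?_,
    by simp [leavesWithin_complete]⟩
  have h_real : (2 : ℝ) ^ j * leavesWithin T (k - j) ≤ d := by
    calc (2 : ℝ) ^ j * leavesWithin T (k - j) ≤ 2 ^ j * (β * 2 ^ (k - j)) := by
          gcongr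
          exact h_within (k.sub_le j)
      _ = β * 2 ^ k := by rw [mul_left_comm, ← pow_add, Nat.add_sub_cancel' hj]
      _ ≤ d := hd
  rw [sum_const, card_range, smul_eq_mul]
  exact_mod_cast h_real

end Profile

/-- The fraction of nodes that are unfinished after `n` generations, if in generation `i` a fraction
`α i` of the unfinished nodes gets finished. -/
noncomputable def survival (α : ℕ → ℝ) (n : ℕ) : ℝ := ∏ i ∈ range n, (1 - α i)

section Survival

variable {α : ℕ → ℝ} {c : ℝ}

theorem survival_succ (α : ℕ → ℝ) (n : ℕ) : survival α (n + 1) = survival α n * (1 - α n) :=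
  prod_range_succ _ _

theorem survival_pos (hα : ∀ i, α i < 1) (n : ℕ) : 0 < survival α n :=
  prod_pos fun i _ => sub_pos.2 (hα i)

theorem exp_mul_le_survival_div (hα : ∀ i, α i < 1) {m j : ℕ}
    (hc : ∀ i, m ≤ i → i < m + j → c ≤ α i) :
    Real.exp (c * j) ≤ survival α m / survival α (m + j) := by
  rw [le_div_iff₀' (survival_pos hα _)]
  induction j with
  | zero => simp
  | succ j ih =>
    have h_factor : (1 - α (m + j)) * Real.exp c ≤ 1 := by
      rw [← le_div_iff₀ (Real.exp_pos c), one_div, ← Real.exp_neg]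
      linarith [Real.one_sub_le_exp_neg c, hc (m + j) (by omega) (by omega)]
    have h_pos := survival_pos hα (m + j)
    calc survival α (m + (j + 1)) * Real.exp (c * (j + 1 : ℕ))
        = survival α (m + j) * Real.exp (c * j) * ((1 - α (m + j)) * Real.exp c) := by
          rw [← add_assoc, survival_succ, Nat.cast_succ, mul_add_one, Real.exp_add]
          ring
      _ ≤ survival α (m + j) * Real.exp (c * j) :=
          mul_le_of_le_one_right (by positivity) h_factor
      _ ≤ survival α m := ih fun i hi hi' => hc i hi (by omega)

theorem survival_le_mul_exp (hα : ∀ i, α i ≤ c) (hc₀ : 0 ≤ c) (hc : c ≤ 1 / 2) (m j : ℕ) :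
    survival α m ≤ survival α (m + j) * Real.exp (2 * c * j) := by
  induction j with
  | zero => simp
  | succ j ih =>
    have h_factor : 1 ≤ (1 - α (m + j)) * Real.exp (2 * c) := by
      calc 1 ≤ (1 - c) * (2 * c + 1) := by nlinarith
        _ ≤ (1 - α (m + j)) * Real.exp (2 * c) := by
          gcongr
          · linarith [hα (m + j)]
          · exact hα _
          · exact Real.add_one_le_exp _
    have h_pos := survival_pos (fun i => (hα i).trans_lt (by linarith)) (m + j)
    calc survival α m ≤ survival α (m + j) * Real.exp (2 * c * j) := ih
      _ ≤ survival α (m + j) * Real.exp (2 * c * j) * ((1 - α (m + j)) * Real.exp (2 * c)) :=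
          le_mul_of_one_le_right (by positivity) h_factor
      _ = survival α (m + (j + 1)) * Real.exp (2 * c * (j + 1 : ℕ)) := by
          rw [← add_assoc, survival_succ, Nat.cast_succ, mul_add_one (2 * c), Real.exp_add]
          ring

theorem exp_one_mul_le_sum_survival_div (hα : ∀ i, α i < 1) {m M : ℕ}
    (hc : ∀ i, m ≤ i → c ≤ α i) :
    Real.exp 1 * (c * (M * (M + 1) / 2)) ≤
      ∑ j ∈ range (M + 1), survival α (m + j) / survival α (m + M) := by
  have h_gauss : ∑ j ∈ range (M + 1), (j : ℝ) = M * (M + 1) / 2 := by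
    have h := sum_range_id_mul_two (M + 1)
    rw [Nat.add_sub_cancel] at h
    rw [eq_div_iff two_ne_zero, mul_comm (M : ℝ), ← Nat.cast_sum]
    exact_mod_cast h
  rw [← sum_range_reflect, ← h_gauss, mul_sum, mul_sum]
  refine sum_le_sum fun j hj => (Real.exp_one_mul_le_exp).trans ?_
  have h_le : j ≤ M := Nat.lt_succ_iff.1 (mem_range.1 hj)
  have h_add : m + M = m + (M + 1 - 1 - j) + j := by omega
  rw [h_add]
  exact exp_mul_le_survival_div hα fun i hi _ => hc i (by omega)

end Survival

/-- The number of nodes, out of the `2 ^ R` descendants of a node of generation `i`, that get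
finished. It grows so slowly that it changes at most once during the `M + 1` generations
over which a leaf is counted. -/
def finished (M A i : ℕ) : ℕ := min (i / (M + 1)) A

/-- The fraction of nodes of generation `i` that get finished. -/
noncomputable def finishRate (R M A i : ℕ) : ℝ := finished M A i / 2 ^ R

section Schedule

variable {R M A : ℕ}

theorem finishRate_le (i : ℕ) : finishRate R M A i ≤ A / 2 ^ R := by
  unfold finishRate finished
  gcongr
  exact min_le_right _ _

theorem survival_finishRate_eq_one {m : ℕ} (hm : m ≤ M + 1) :
    survival (finishRate R M A) m = 1 := by
  refine prod_eq_one fun i hi => ?_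
  have h_div : i / (M + 1) = 0 := Nat.div_eq_of_lt ((mem_range.1 hi).trans_le hm)
  simp [finishRate, finished, h_div]

theorem finished_le_finished_add_one {n i : ℕ} (hi : n ≤ i) :
    finished M A (n + M + 1) ≤ finished M A i + 1 := by
  have h_div : (n + M + 1) / (M + 1) = n / (M + 1) + 1 := Nat.add_div_right n M.succ_pos
  have := Nat.div_le_div_right (c := M + 1) hi
  unfold finished
  omega

theorem finished_add_two_le (hM : 0 < M) (hMR : M ^ 2 ≤ 2 ^ R)
    (hα : ∀ i, finishRate R M A i < 1) (n : ℕ) :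
    (finished M A (n + M + 1) : ℝ) + 2 ≤ Real.exp (-1 + 3 / M) / M * 2 ^ R *
      (survival (finishRate R M A) (n + 1) / survival (finishRate R M A) (n + M + 1)) := by
  set b := finished M A (n + M + 1)
  have hM' : (0 : ℝ) < M := Nat.cast_pos.2 hM
  have h_ratio : Real.exp (((b : ℝ) - 1) / 2 ^ R * M) ≤
      survival (finishRate R M A) (n + 1) / survival (finishRate R M A) (n + M + 1) := by
    rw [add_right_comm]
    refine exp_mul_le_survival_div hα fun i hi _ => ?_
    unfold finishRate
    gcongr
    rw [sub_le_iff_le_add]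
    exact_mod_cast finished_le_finished_add_one (n.le_succ.trans hi)
  have h_small : 3 * M / 2 ^ R ≤ (3 / M : ℝ) := by
    rw [div_le_div_iff₀ (by positivity) hM', mul_assoc, ← sq]
    exact mul_le_mul_of_nonneg_left (by exact_mod_cast hMR) zero_le_three
  calc (b : ℝ) + 2 = M * ((b : ℝ) + 2) / 2 ^ R / M * 2 ^ R := by field_simp
    _ ≤ Real.exp (-1 + 3 / M + ((b : ℝ) - 1) / 2 ^ R * M) / M * 2 ^ R := by
        gcongr
        calc M * ((b : ℝ) + 2) / 2 ^ R = (M * ((b : ℝ) + 2) / 2 ^ R - 1) + 1 := by ring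
          _ ≤ Real.exp (M * ((b : ℝ) + 2) / 2 ^ R - 1) := Real.add_one_le_exp _
          _ = Real.exp (-1 + 3 * M / 2 ^ R + ((b : ℝ) - 1) / 2 ^ R * M) := by ring_nf
          _ ≤ Real.exp (-1 + 3 / M + ((b : ℝ) - 1) / 2 ^ R * M) := by gcongr
    _ = Real.exp (-1 + 3 / M) / M * 2 ^ R * Real.exp (((b : ℝ) - 1) / 2 ^ R * M) := by
        rw [Real.exp_add]
        ring
    _ ≤ _ := by gcongr

theorem three_le_sum_survival_finishRate (hM : 0 < M) (hA : 6 / M ≤ (A : ℝ) / 2 ^ R)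
    (hα : ∀ i, finishRate R M A i < 1) {n : ℕ} (hn : A * (M + 1) ≤ n) :
    3 ≤ Real.exp (-1 + 3 / M) / M * ∑ j ∈ range (M + 1),
      survival (finishRate R M A) (n + 1 + j) / survival (finishRate R M A) (n + M + 1) := by
  have hM' : (0 : ℝ) < M := Nat.cast_pos.2 hM
  have h_rate : ∀ i, n + 1 ≤ i → (6 / M : ℝ) ≤ finishRate R M A i := fun i hi => by
    have h_div : A ≤ i / (M + 1) := (Nat.le_div_iff_mul_le (by omega)).2 (by omega)
    rwa [finishRate, finished, min_eq_right h_div]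
  calc 3 ≤ 3 * (M + 1) / (M : ℝ) := by
        rw [le_div_iff₀ hM']
        linarith
    _ = Real.exp (-1) / M * (Real.exp 1 * (6 / M * (M * (M + 1) / 2))) := by
        rw [Real.exp_neg]
        field_simp
        norm_num
    _ ≤ _ := by
        rw [add_right_comm n M]
        gcongr
        · exact le_add_of_nonneg_right (by positivity)
        · exact exp_one_mul_le_sum_survival_div hα h_rate

end Schedule

theorem exists_sparse {R M A d k : ℕ} {β γ : ℝ} (hM : 0 < M) (hR : 0 < R) (hβ : 0 ≤ β)
    (hMR : M ^ 2 ≤ 2 ^ R) (hβ' : R * β = Real.exp (-1 + 3 / M) / M)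
    (hA : 6 / M ≤ (A : ℝ) / 2 ^ R) (hγ : (A : ℝ) / 2 ^ R ≤ γ) (hγ' : γ ≤ 1 / 2)
    (hk : k = R * (M + 2))
    (hd : β * 2 ^ k * (Real.exp (2 * γ) + 2 * (Real.exp (2 * γ * M) / 2 ^ R)) ≤ d) :
    ∃ T, Sparse k d T ∧ leavesWithin T k = 0 := by
  subst hk
  set u := survival (finishRate R M A)
  have hγ₀ : 0 ≤ γ := le_trans (by positivity) hγ
  have h_rate (i : ℕ) : finishRate R M A i ≤ γ := (finishRate_le i).trans hγ
  have h_lt (i : ℕ) : finishRate R M A i < 1 := (h_rate i).trans_lt (by linarith)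
  have hu₀ : ∀ m, 0 < u m := survival_pos h_lt
  have hu : ∀ m j : ℕ, u m ≤ u (m + j) * Real.exp (2 * γ * j) :=
    survival_le_mul_exp h_rate hγ₀ hγ'
  have h_last : Constructible (R * (M + 2)) d (profile β R M u (A * (M + 1))) :=
    constructible_profile_of_le_sum hR hβ (by positivity) hu₀ hu hd <|
      hβ' ▸ three_le_sum_survival_finishRate hM hA h_lt le_rfl
  have h_first : Constructible (R * (M + 2)) d (profile β R M u 0) :=
    Nat.decreasingInduction
      (motive := fun n _ => Constructible (R * (M + 2)) d (profile β R M u n))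
      (fun n _ => constructible_profile_of_succ hR hM hβ (by positivity) hu₀ hu hd
        (survival_succ _ _) (hβ' ▸ finished_add_two_le hM hMR h_lt n))
      h_last (A * (M + 1)).zero_le
  refine exists_sparse_of_constructible_profile hβ
    (fun m hm => survival_finishRate_eq_one (by omega)) rfl ?_ h_first
  refine (le_mul_of_one_le_right (by positivity) ?_).trans hd
  exact (Real.one_le_exp (by positivity)).trans (le_add_of_nonneg_right (by positivity))

theorem exp_div_add_le {M : ℕ} (hM : 0 < M) (h : 2 * Real.exp 14 * M ^ 2 ≤ 2 ^ M) :
    Real.exp (2 * (7 / M)) + 2 * (Real.exp (2 * (7 / M) * M) / 2 ^ (M + 2)) ≤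
      Real.exp (15 / M) := by
  have hM' : (1 : ℝ) ≤ M := by exact_mod_cast hM
  have h_small : 2 * (Real.exp (2 * (7 / M) * M) / 2 ^ (M + 2)) ≤ 1 / M := by
    rw [show 2 * (7 / M) * M = (14 : ℝ) by field_simp; norm_num, ← mul_div_assoc,
      div_le_div_iff₀ (by positivity) (by positivity), one_mul]
    calc 2 * Real.exp 14 * M ≤ 2 * Real.exp 14 * M ^ 2 := by
          gcongr
          exact le_self_pow₀ hM' two_ne_zero
      _ ≤ 2 ^ M := h
      _ ≤ 2 ^ (M + 2) := pow_le_pow_right₀ one_le_two (Nat.le_add_right _ _)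
  have h_one : 1 ≤ Real.exp (2 * (7 / M)) := Real.one_le_exp (by positivity)
  calc Real.exp (2 * (7 / M)) + 2 * (Real.exp (2 * (7 / M) * M) / 2 ^ (M + 2))
      ≤ Real.exp (2 * (7 / M)) + Real.exp (2 * (7 / M)) * (1 / M) := by
        refine add_le_add_right (h_small.trans ?_) _
        exact le_mul_of_one_le_left (by positivity) h_one
    _ = Real.exp (2 * (7 / M)) * (1 / M + 1) := by ring
    _ ≤ Real.exp (2 * (7 / M)) * Real.exp (1 / M) := by
        gcongr
        exact Real.add_one_le_exp _
    _ = Real.exp (15 / M) := by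
        rw [← Real.exp_add]
        ring_nf

theorem exists_sparse_of_exp_le {M d : ℕ} (hM : 14 ≤ M) (h : 2 * Real.exp 14 * M ^ 2 ≤ 2 ^ M)
    (hd : Real.exp (-1 + 18 / M) / ((M + 2) * M) * 2 ^ ((M + 2) ^ 2) ≤ d) :
    ∃ T, Sparse ((M + 2) ^ 2) d T ∧ leavesWithin T ((M + 2) ^ 2) = 0 := by
  have hM' : (14 : ℝ) ≤ M := by exact_mod_cast hM
  have h_pow : (M : ℝ) ^ 2 ≤ 2 ^ (M + 2) := by
    calc (M : ℝ) ^ 2 ≤ 2 * Real.exp 14 * M ^ 2 :=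
          le_mul_of_one_le_left (by positivity) (by linarith [Real.one_le_exp (x := 14) (by simp)])
      _ ≤ 2 ^ M := h
      _ ≤ 2 ^ (M + 2) := pow_le_pow_right₀ one_le_two (Nat.le_add_right _ _)
  have hA : ((⌈6 * 2 ^ (M + 2) / (M : ℝ)⌉₊ : ℕ) : ℝ) / 2 ^ (M + 2) ≤ 7 / M := by
    rw [div_le_div_iff₀ (by positivity) (by positivity)]
    calc (⌈6 * 2 ^ (M + 2) / (M : ℝ)⌉₊ : ℝ) * M ≤ (6 * 2 ^ (M + 2) / M + 1) * M := by
          gcongr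
          exact (Nat.ceil_lt_add_one (by positivity)).le
      _ = 6 * 2 ^ (M + 2) + M := by field_simp
      _ ≤ 7 * 2 ^ (M + 2) := by nlinarith
  refine exists_sparse (R := M + 2) (M := M) (A := ⌈6 * 2 ^ (M + 2) / (M : ℝ)⌉₊)
    (β := Real.exp (-1 + 3 / M) / ((M + 2) * M)) (γ := 7 / M) (by omega) (by omega)
    (by positivity) (by exact_mod_cast h_pow) ?_ ?_ hA ?_ (sq _) ?_
  · push_cast
    field_simp
  · rw [le_div_iff₀ (by positivity), div_mul_eq_mul_div]
    exact Nat.le_ceil _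
  · rw [div_le_div_iff₀ (by positivity) two_pos]
    linarith
  · calc Real.exp (-1 + 3 / M) / ((M + 2) * M) * 2 ^ ((M + 2) ^ 2) *
          (Real.exp (2 * (7 / M)) + 2 * (Real.exp (2 * (7 / M) * M) / 2 ^ (M + 2)))
        ≤ Real.exp (-1 + 3 / M) / ((M + 2) * M) * 2 ^ ((M + 2) ^ 2) * Real.exp (15 / M) := by
          gcongr
          exact exp_div_add_le (by omega) h
      _ = Real.exp (-1 + 18 / M) / ((M + 2) * M) * 2 ^ ((M + 2) ^ 2) := by
          rw [show (-1 + 18 / M : ℝ) = -1 + 3 / M + 15 / M by ring, Real.exp_add _ (15 / M : ℝ)]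
          ring
      _ ≤ d := hd

/-! ### Asymptotics -/

theorem l_le_of_sparse {k d r : ℕ} {T : BinTree} (hk : 1 ≤ k + r) (hd : 0 < d)
    (hT : Sparse k d T) (h : leavesWithin T k = 0) : l (k + r) ≤ (k + r) * (2 ^ r * d) := by
  obtain ⟨T', hT', h'⟩ := exists_sparse_add hd hT h r
  exact ((isGreatest_l hk).1.lt_of_not (not_admissible_of_sparse hT' h')).le

theorem l_div_two_pow_le {k M : ℕ} (hM : 22 ≤ M) (h : 2 * Real.exp 14 * M ^ 2 ≤ 2 ^ M)
    (hk : (M + 2) ^ 2 ≤ k) (hk' : k ≤ (M + 2) * (M + 4)) :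
    (l k : ℝ) / 2 ^ k ≤ Real.exp (-1 + 22 / M) + 1 / M := by
  obtain ⟨r, rfl⟩ := Nat.exists_eq_add_of_le hk
  have hM' : (0 : ℝ) < M := by exact_mod_cast (by omega : 0 < M)
  have hn : (M + 2) * 3 ≤ (M + 2) ^ 2 := by nlinarith
  set n := (M + 2) ^ 2
  set X : ℝ := Real.exp (-1 + 18 / M) / ((M + 2) * M) * 2 ^ n
  have hX : 0 < X := by positivity
  obtain ⟨T, hT, hT'⟩ := exists_sparse_of_exp_le (by omega) h (Nat.le_ceil X)
  have h_l : (l (n + r) : ℝ) ≤ (n + r : ℕ) * (2 ^ r * ⌈X⌉₊) := by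
    exact_mod_cast l_le_of_sparse (by omega) (Nat.ceil_pos.2 hX) hT hT'
  have h_k : ((n + r : ℕ) : ℝ) ≤ (M + 2) * (M + 4) := by exact_mod_cast hk'
  have h_main : (M + 4) / M * Real.exp (-1 + 18 / M) ≤ Real.exp (-1 + 22 / M) := by
    calc (M + 4) / M * Real.exp (-1 + 18 / M) = (4 / M + 1) * Real.exp (-1 + 18 / M) := by
          rw [add_div, div_self hM'.ne', add_comm]
      _ ≤ Real.exp (4 / M) * Real.exp (-1 + 18 / M) := by
          gcongr
          exact Real.add_one_le_exp _
      _ = Real.exp (-1 + 22 / M) := by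
          rw [← Real.exp_add]
          ring_nf
  have h_round : (M + 2 : ℝ) * (M + 4) / 2 ^ n ≤ 1 / M := by
    rw [div_le_div_iff₀ (by positivity) hM', one_mul]
    have h_two : (M + 3 : ℝ) ≤ 2 ^ (M + 2) := by exact_mod_cast Nat.lt_two_pow_self (n := M + 2)
    calc (M + 2 : ℝ) * (M + 4) * M ≤ (M + 3) ^ 3 := by nlinarith
      _ ≤ (2 ^ (M + 2)) ^ 3 := by gcongr
      _ ≤ 2 ^ n := by
          rw [← pow_mul]
          exact pow_le_pow_right₀ one_le_two hn
  calc (l (n + r) : ℝ) / 2 ^ (n + r)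
      ≤ (M + 2) * (M + 4) * (2 ^ r * (X + 1)) / 2 ^ (n + r) := by
        gcongr
        refine h_l.trans ?_
        gcongr
        exact (Nat.ceil_lt_add_one hX.le).le
    _ = (M + 4) / M * Real.exp (-1 + 18 / M) + (M + 2) * (M + 4) / 2 ^ n := by
        rw [pow_add]
        field_simp
        simp only [X]
        field_simp
    _ ≤ Real.exp (-1 + 22 / M) + 1 / M := add_le_add h_main h_round

theorem exp_neg_one_add_div_le {M : ℕ} (hM : 22 ≤ M) :
    Real.exp (-1 + 22 / M) ≤ (Real.exp 1)⁻¹ + 44 / M := by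
  have h_small : |(22 / M : ℝ)| ≤ 1 := by
    rw [abs_of_nonneg (by positivity)]
    exact div_le_one_of_le₀ (by exact_mod_cast hM) (Nat.cast_nonneg M)
  have h_exp := (le_abs_self _).trans (Real.abs_exp_sub_one_le h_small)
  rw [abs_of_nonneg (by positivity)] at h_exp
  have h_inv : (Real.exp 1)⁻¹ ≤ 1 := inv_le_one_of_one_le₀ (Real.one_le_exp zero_le_one)
  calc Real.exp (-1 + 22 / M) = (Real.exp 1)⁻¹ + (Real.exp 1)⁻¹ * (Real.exp (22 / M) - 1) := by
        rw [Real.exp_add, Real.exp_neg]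
        ring
    _ ≤ (Real.exp 1)⁻¹ + 1 * (2 * (22 / M)) := by
        gcongr
        exact sub_nonneg.2 (Real.one_le_exp (by positivity))
    _ = (Real.exp 1)⁻¹ + 44 / M := by ring

theorem eventually_mul_sq_le_two_pow (c : ℝ) : ∀ᶠ n : ℕ in Filter.atTop, c * n ^ 2 ≤ 2 ^ n := by
  have h_tendsto := (tendsto_pow_const_div_const_pow_of_one_lt 2 one_lt_two).const_mul c
  rw [mul_zero] at h_tendsto
  filter_upwards [h_tendsto.eventually_le_const one_pos] with n hn
  rwa [← mul_div_assoc, div_le_one (by positivity)] at hn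

theorem tendsto_sqrt_sub_two : Filter.Tendsto (fun k => Nat.sqrt k - 2) Filter.atTop Filter.atTop :=
  Filter.tendsto_atTop_atTop.2 fun b => ⟨(b + 2) ^ 2, fun _ hk =>
    Nat.le_sub_of_add_le (Nat.le_sqrt'.2 hk)⟩

theorem eventually_l_div_two_pow_le :
    ∀ᶠ k : ℕ in Filter.atTop, (l k : ℝ) / 2 ^ k ≤ (Real.exp 1)⁻¹ + 90 / √k := by
  filter_upwards [tendsto_sqrt_sub_two.eventually (Filter.eventually_ge_atTop 22),
    tendsto_sqrt_sub_two.eventually (eventually_mul_sq_le_two_pow (2 * Real.exp 14))] with k hM h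
  set M := Nat.sqrt k - 2
  have h_sqrt : Nat.sqrt k = M + 2 := by omega
  have h_lower : (M + 2) ^ 2 ≤ k := h_sqrt ▸ Nat.sqrt_le' k
  have h_upper : k ≤ (M + 2) * (M + 4) := by
    have := Nat.sqrt_le_add k
    rw [h_sqrt] at this
    linarith
  have h_M : 45 / (M : ℝ) ≤ 90 / √k := by
    have h_real : √(k : ℝ) ≤ M + 3 := by
      have := Real.real_sqrt_le_nat_sqrt_succ (a := k)
      rw [h_sqrt] at this
      push_cast at this
      linarith
    have hM' : (22 : ℝ) ≤ M := by exact_mod_cast hM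
    have hk : (0 : ℝ) < k := by exact_mod_cast lt_of_lt_of_le (by positivity) h_lower
    rw [div_le_div_iff₀ (by positivity) (Real.sqrt_pos.2 hk)]
    linarith
  calc (l k : ℝ) / 2 ^ k ≤ Real.exp (-1 + 22 / M) + 1 / M :=
        l_div_two_pow_le hM h h_lower h_upper
    _ ≤ (Real.exp 1)⁻¹ + 44 / M + 1 / M := by
        gcongr
        exact exp_neg_one_add_div_le hM
    _ = (Real.exp 1)⁻¹ + 45 / M := by ring
    _ ≤ (Real.exp 1)⁻¹ + 90 / √k := by gcongr

theorem inv_exp_one_sub_le_l_div_two_pow {k : ℕ} (hk : 1 ≤ k) :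
    (Real.exp 1)⁻¹ - 2 / √k ≤ (l k : ℝ) / 2 ^ k := by
  have h_floor : (⌊(2 : ℝ) ^ k / Real.exp 1⌋ : ℝ) - 1 ≤ l k := by
    exact_mod_cast floor_two_pow_div_exp_sub_one_le_l hk
  have hk' : (1 : ℝ) ≤ k := by exact_mod_cast hk
  have h_sqrt : √(k : ℝ) ≤ 2 ^ k := by
    calc √(k : ℝ) ≤ k := (Real.sqrt_le_left (by positivity)).2 (le_self_pow₀ hk' two_ne_zero)
      _ ≤ 2 ^ k := by exact_mod_cast Nat.lt_two_pow_self.le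
  calc (Real.exp 1)⁻¹ - 2 / √k ≤ (Real.exp 1)⁻¹ - 2 / 2 ^ k := by gcongr
    _ = (2 ^ k / Real.exp 1 - 2) / 2 ^ k := by field_simp
    _ ≤ (l k : ℝ) / 2 ^ k := by
        gcongr
        linarith [Int.lt_floor_add_one ((2 : ℝ) ^ k / Real.exp 1)]

theorem isBigO_l_div_two_pow_sub :
    (fun k : ℕ => (l k : ℝ) / 2 ^ k - (Real.exp 1)⁻¹) =O[Filter.atTop]
      fun k : ℕ => (k : ℝ) ^ (-(1 / 2) : ℝ) := by
  refine Asymptotics.IsBigO.of_bound 90 ?_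
  filter_upwards [eventually_l_div_two_pow_le, Filter.eventually_ge_atTop 1] with k h_upper hk
  have h_lower := inv_exp_one_sub_le_l_div_two_pow hk
  have h_le : 2 / √(k : ℝ) ≤ 90 / √k := by
    gcongr
    norm_num
  rw [Real.rpow_neg k.cast_nonneg, ← Real.sqrt_eq_rpow, norm_inv,
    Real.norm_of_nonneg (Real.sqrt_nonneg _), ← div_eq_mul_inv, Real.norm_eq_abs, abs_le]
  constructor <;> linarith

theorem exists_abs_l_div_two_pow_sub_le :
    ∃ K : ℝ, ∀ k : ℕ, 1 ≤ k →
      |(l k : ℝ) / 2 ^ k - (Real.exp 1)⁻¹| ≤ K * (k : ℝ) ^ (-(1 / 2) : ℝ) := by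
  obtain ⟨K, -, hK⟩ := Asymptotics.bound_of_isBigO_nat_atTop isBigO_l_div_two_pow_sub
  refine ⟨K, fun k hk => ?_⟩
  have h_pos : 0 < (k : ℝ) ^ (-(1 / 2) : ℝ) := Real.rpow_pos_of_pos (Nat.cast_pos.2 hk) _
  simpa only [Real.norm_eq_abs, abs_of_pos h_pos] using hK h_pos.ne'

end KSat

theorem theorem2 :
    (∀ k : ℕ, 1 ≤ k →
      IsGreatest {d : ℕ | KSat.Admissible k d} (KSat.l k) ∧
      ⌊(2 : ℝ) ^ k / Real.exp 1⌋ - 1 ≤ (KSat.l k : ℤ)) ∧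
    ∃ K : ℝ, ∀ k : ℕ, 1 ≤ k →
      ∃ ε : ℝ, |ε| ≤ K * (k : ℝ) ^ (-(1 / 2) : ℝ) ∧
        (KSat.l k : ℝ) = ((Real.exp 1)⁻¹ + ε) * 2 ^ k := by
  obtain ⟨K, hK⟩ := KSat.exists_abs_l_div_two_pow_sub_le
  refine ⟨fun k hk => ⟨KSat.isGreatest_l hk, KSat.floor_two_pow_div_exp_sub_one_le_l hk⟩,
    K, fun k hk => ⟨KSat.l k / 2 ^ k - (Real.exp 1)⁻¹, hK k hk, ?_⟩⟩
  rw [add_sub_cancel, div_mul_cancel₀ _ (by positivity)]
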